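/- Let $A\in\mathbb{C}^{m\times n}$ and $W\in\mathbb{C}^{n\times m}$. Let $\mathrm{ind}(M)$ denote the smallest $k\ge 0$ with $r(M^k)=r(M^{k+1})$ for a square matrix $M$ ($r(\cdot)$ is the rank), let $k=\mathrm{ind}(A,W)=\max\{\mathrm{ind}(AW),\mathrm{ind}(WA)\}$, and let $A\{1',2',3',{1^k}'\}$ be the set of all $X\in\mathbb{C}^{m\times n}$ with $$AWXWA=A,\quad XWAWX=X,\quad (WAWX)^*=WAWX,\quad XW(AW)^{k+1}=(AW)^k .$$ The weighted Drazin inverse $A^{D,W}$ is the unique $X\in\mathbb{C}^{m\times n}$ with $XW(AW)^{k+1}=(AW)^k$, $XWAWX=X$, $AWX=XWA$, and $(\cdot)^\dagger$ is the Moore–Penrose inverse. Assume $r(WAW)=r(A)=r$. Let $$A=S\begin{bmatrix}A_1&0\\0&A_2\end{bmatrix}R^{-1},\qquad W=R\begin{bmatrix}W_1&0\\0&W_2\end{bmatrix}S^{-1},$$ where $S\in\mathbb{C}^{m\times m}$, $R\in\mathbb{C}^{n\times n}$ and $A_1,W_1\in\mathbb{C}^{t\times t}$ are nonsingular and $A_2W_2$,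 $W_2A_2$ are nilpotent. Let $$WAW=P\begin{bmatrix}B_1&0\\0&0\end{bmatrix}Q^{-1}$$ be a singular value decomposition, with $P\in\mathbb{C}^{n\times n}$, $Q\in\mathbb{C}^{m\times m}$ unitary and $B_1\in\mathbb{C}^{r\times r}$ diagonal with positive diagonal entries. Write $$Q^{-1}S=\begin{bmatrix}Q_1&Q_2\\Q_3&Q_4\end{bmatrix},\ Q_1\in\mathbb{C}^{r\times t},\qquad R^{-1}P=\begin{bmatrix}R_1&R_2\\R_3&R_4\end{bmatrix},\ R_1\in\mathbb{C}^{t\times r},\qquad G=(W_1A_1W_1)^{-1}.$$ Then: 1. $A^{D,W}=S\begin{bmatrix}G&0\\0&0\end{bmatrix}R^{-1}$ and $(WAW)^\dagger=Q\begin{bmatrix}B_1^{-1}&0\\0&0\end{bmatrix}P^{-1}$. 2. $(WAW)^\dagger+(I_m-(WAW)^\dagger WAW)A^{D,W}WAW(WAW)^\dagger=Q\begin{bmatrix}B_1^{-1}&0\\Q_3GR_1&0\end{bmatrix}P^{-1}$. 3. Both matrices $$Q\begin{bmatrix}B_1^{-1}&0\\Q_3GR_1+Q_4A_2R_3&0\end{bmatrix}P^{-1}\quad\text{and}\quad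 Q\begin{bmatrix}B_1^{-1}&0\\Q_3GR_1&0\end{bmatrix}P^{-1}$$ belong to $A\{1',2',3',{1^k}'\}$. 4. Let $A^{\ominus,W}$ be either of the two matrices in 3. Every $X\in A\{1',2',3',{1^k}'\}$ has the form $$X=A^{\ominus,W}+Q\begin{bmatrix}0&0\\E&0\end{bmatrix}P^{-1},\qquad E=U_3(B_1^{-1}-Q_1GR_1)-U_4Q_3GR_1,$$ for some $U\in\mathbb{C}^{m\times m}$ with $Q^{-1}UQ=\begin{bmatrix}U_1&U_2\\U_3&U_4\end{bmatrix}$, $U_1\in\mathbb{C}^{r\times r}$. More precisely, the term with $U_4$ is not needed, and then the description is exact: $$A\{1',2',3',{1^k}'\}=\left\{A^{\ominus,W}+Q\begin{bmatrix}0&0\\U_3(B_1^{-1}-Q_1GR_1)&0\end{bmatrix}P^{-1}\ :\ U_3\in\mathbb{C}^{(m-r)\times r}\right\}.$$ -/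

import Mathlib

open Matrix

/-- The splitting of `m` coordinates into the first `p` and the remaining `m - p`. -/
def splitEquiv {p m : ℕ} (h : p ≤ m) : Fin p ⊕ Fin (m - p) ≃ Fin m :=
  finSumFinEquiv.trans (finCongr (Nat.add_sub_of_le h))

/-- The `m × n` matrix `[[X₁, X₂], [X₃, X₄]]` whose upper left block `X₁` is `p × q`. -/
def blockMat {p q m n : ℕ} (hp : p ≤ m) (hq : q ≤ n)
    (X₁ : Matrix (Fin p) (Fin q) ℂ) (X₂ : Matrix (Fin p) (Fin (n - q)) ℂ)
    (X₃ : Matrix (Fin (m - p)) (Fin q) ℂ) (X₄ : Matrix (Fin (m - p)) (Fin (n - q)) ℂ) :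
    Matrix (Fin m) (Fin n) ℂ :=
  Matrix.reindex (splitEquiv hp) (splitEquiv hq) (Matrix.fromBlocks X₁ X₂ X₃ X₄)

/-- The index of a square matrix: the smallest `k ≥ 0` with `r(M ^ k) = r(M ^ (k + 1))`. -/
noncomputable def matIndex {m : ℕ} (M : Matrix (Fin m) (Fin m) ℂ) : ℕ :=
  sInf {k : ℕ | (M ^ k).rank = (M ^ (k + 1)).rank}

/-- `ind(A, W) = max {ind(AW), ind(WA)}`. -/
noncomputable def weightedIndex {m n : ℕ} (A : Matrix (Fin m) (Fin n) ℂ)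
    (W : Matrix (Fin n) (Fin m) ℂ) : ℕ :=
  max (matIndex (A * W)) (matIndex (W * A))

/-- `X` is the Moore-Penrose inverse of `M`: the four Penrose equations. -/
structure IsMoorePenrose {m n : ℕ} (M : Matrix (Fin m) (Fin n) ℂ)
    (X : Matrix (Fin n) (Fin m) ℂ) : Prop where
  inner : M * X * M = M
  outer : X * M * X = X
  left_herm : (M * X)ᴴ = M * X
  right_herm : (X * M)ᴴ = X * M

/-- `X` is the `W`-weighted Drazin inverse of `A`, with `k = ind(A, W)`. -/
structure IsWeightedDrazin {m n : ℕ} (A : Matrix (Fin m) (Fin n) ℂ)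
    (W : Matrix (Fin n) (Fin m) ℂ) (X : Matrix (Fin m) (Fin n) ℂ) : Prop where
  power : X * W * (A * W) ^ (weightedIndex A W + 1) = (A * W) ^ weightedIndex A W
  outer : X * W * A * W * X = X
  comm : A * W * X = X * W * A

/-- The set `A{1', 2', 3', 1ᵏ'}` of the `W`-weighted `{1, 2, 3, 1ᵏ}`-inverses of `A`. -/
def weightedInverses {m n : ℕ} (A : Matrix (Fin m) (Fin n) ℂ)
    (W : Matrix (Fin n) (Fin m) ℂ) (k : ℕ) : Set (Matrix (Fin m) (Fin n) ℂ) :=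
  {X | A * W * X * W * A = A ∧ X * W * A * W * X = X ∧
    (W * A * W * X)ᴴ = W * A * W * X ∧ (X * W) * (A * W) ^ (k + 1) = (A * W) ^ k}

/-! Put `M = WAW`. The rank hypothesis lets `A` be recovered from `M` as `A = Y M Z`, so `AWXWA = A`
becomes `MXM = M`, and the first three conditions say that `X` is a {1,2,3}-inverse of `M`. By the
singular value decomposition such `X` are exactly `Q [[B₁⁻¹, 0], [C, 0]] P⁻¹` with `C` free
(`inverse123_iff`).

The power condition reads `X M (AW)^k = (AW)^k`. As `k ≥ ind(AW)`, the nilpotent block of `(AW)^k`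
vanishes (`nilpotent_part_pow_eq_zero`), while its core block is invertible; what remains is the
linear equation `C B₁ Q₁ = Q₃`.

Comparing the two decompositions of `M` gives `R₁ B₁ Q₁ = W₁ A₁ W₁` and `R₃ B₁ Q₁ = 0`. So `G R₁ B₁`
is a left inverse of `Q₁`: `C = Q₃ G R₁` is a solution, adding `Q₄ A₂ R₃` keeps it one, and the
homogeneous solutions are the `U₃ (B₁⁻¹ - Q₁ G R₁)`. -/

section BlockMat

variable {p q s m n l : ℕ} (hp : p ≤ m) (hq : q ≤ n) (hs : s ≤ l)

theorem blockMat_mul (X₁ : Matrix (Fin p) (Fin q) ℂ) (X₂ : Matrix (Fin p) (Fin (n - q)) ℂ)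
    (X₃ : Matrix (Fin (m - p)) (Fin q) ℂ) (X₄ : Matrix (Fin (m - p)) (Fin (n - q)) ℂ)
    (Y₁ : Matrix (Fin q) (Fin s) ℂ) (Y₂ : Matrix (Fin q) (Fin (l - s)) ℂ)
    (Y₃ : Matrix (Fin (n - q)) (Fin s) ℂ) (Y₄ : Matrix (Fin (n - q)) (Fin (l - s)) ℂ) :
    blockMat hp hq X₁ X₂ X₃ X₄ * blockMat hq hs Y₁ Y₂ Y₃ Y₄ =
      blockMat hp hs (X₁ * Y₁ + X₂ * Y₃) (X₁ * Y₂ + X₂ * Y₄)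
        (X₃ * Y₁ + X₄ * Y₃) (X₃ * Y₂ + X₄ * Y₄) := by
  simp [blockMat, Matrix.fromBlocks_multiply, Matrix.submatrix_mul_equiv]

theorem blockMat_add (X₁ : Matrix (Fin p) (Fin q) ℂ) (X₂ : Matrix (Fin p) (Fin (n - q)) ℂ)
    (X₃ : Matrix (Fin (m - p)) (Fin q) ℂ) (X₄ : Matrix (Fin (m - p)) (Fin (n - q)) ℂ)
    (Y₁ : Matrix (Fin p) (Fin q) ℂ) (Y₂ : Matrix (Fin p) (Fin (n - q)) ℂ)
    (Y₃ : Matrix (Fin (m - p)) (Fin q) ℂ) (Y₄ : Matrix (Fin (m - p)) (Fin (n - q)) ℂ) :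
    blockMat hp hq X₁ X₂ X₃ X₄ + blockMat hp hq Y₁ Y₂ Y₃ Y₄ =
      blockMat hp hq (X₁ + Y₁) (X₂ + Y₂) (X₃ + Y₃) (X₄ + Y₄) := by
  simp only [blockMat, ← Matrix.fromBlocks_add]
  rfl

theorem blockMat_one : blockMat hp hp 1 0 0 1 = 1 := by
  simp [blockMat, Matrix.fromBlocks_one]

theorem blockMat_conjTranspose
    (X₁ : Matrix (Fin p) (Fin q) ℂ) (X₂ : Matrix (Fin p) (Fin (n - q)) ℂ)
    (X₃ : Matrix (Fin (m - p)) (Fin q) ℂ) (X₄ : Matrix (Fin (m - p)) (Fin (n - q)) ℂ) :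
    (blockMat hp hq X₁ X₂ X₃ X₄)ᴴ = blockMat hq hp X₁ᴴ X₃ᴴ X₂ᴴ X₄ᴴ := by
  simp only [blockMat, Matrix.conjTranspose_reindex, Matrix.fromBlocks_conjTranspose]

theorem blockMat_inj {X₁ : Matrix (Fin p) (Fin q) ℂ} {X₂ : Matrix (Fin p) (Fin (n - q)) ℂ}
    {X₃ : Matrix (Fin (m - p)) (Fin q) ℂ} {X₄ : Matrix (Fin (m - p)) (Fin (n - q)) ℂ}
    {Y₁ : Matrix (Fin p) (Fin q) ℂ} {Y₂ : Matrix (Fin p) (Fin (n - q)) ℂ}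
    {Y₃ : Matrix (Fin (m - p)) (Fin q) ℂ} {Y₄ : Matrix (Fin (m - p)) (Fin (n - q)) ℂ} :
    blockMat hp hq X₁ X₂ X₃ X₄ = blockMat hp hq Y₁ Y₂ Y₃ Y₄ ↔
      X₁ = Y₁ ∧ X₂ = Y₂ ∧ X₃ = Y₃ ∧ X₄ = Y₄ := by
  simp only [blockMat, EmbeddingLike.apply_eq_iff_eq, Matrix.fromBlocks_inj]

theorem exists_eq_blockMat (X : Matrix (Fin m) (Fin n) ℂ) :
    ∃ X₁ X₂ X₃ X₄, X = blockMat hp hq X₁ X₂ X₃ X₄ := by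
  set Y := (Matrix.reindex (splitEquiv hp) (splitEquiv hq)).symm X with hY
  refine ⟨Y.toBlocks₁₁, Y.toBlocks₁₂, Y.toBlocks₂₁, Y.toBlocks₂₂, ?_⟩
  rw [blockMat, Matrix.fromBlocks_toBlocks, hY, Equiv.apply_symm_apply]

theorem blockMat_diag_pow (X : Matrix (Fin p) (Fin p) ℂ)
    (Y : Matrix (Fin (m - p)) (Fin (m - p)) ℂ) (k : ℕ) :
    blockMat hp hp X 0 0 Y ^ k = blockMat hp hp (X ^ k) 0 0 (Y ^ k) := by
  induction k with
  | zero => simp [blockMat_one]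
  | succ k ih => simp [pow_succ, ih, blockMat_mul]

end BlockMat

/-! ### Multiplication by invertible matrices. -/

theorem mul_mul_inv_inj {a b : ℕ} {T : Matrix (Fin a) (Fin a) ℂ} {V : Matrix (Fin b) (Fin b) ℂ}
    (hT : IsUnit T.det) (hV : IsUnit V.det) {Y Z : Matrix (Fin a) (Fin b) ℂ} :
    T * Y * V⁻¹ = T * Z * V⁻¹ ↔ Y = Z := by
  refine ⟨fun h => ?_, fun h => by rw [h]⟩
  have := congrArg (fun U => T⁻¹ * U * V) h
  simpa only [Matrix.mul_assoc, Matrix.nonsing_inv_mul _ hV, Matrix.mul_one,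
    Matrix.nonsing_inv_mul_cancel_left _ _ hT] using this

theorem matrix_conj_pow {a : ℕ} {T : Matrix (Fin a) (Fin a) ℂ} (hT : IsUnit T.det)
    (Y : Matrix (Fin a) (Fin a) ℂ) (i : ℕ) : (T * Y * T⁻¹) ^ i = T * Y ^ i * T⁻¹ := by
  induction i with
  | zero => simp [Matrix.mul_nonsing_inv _ hT]
  | succ i ih =>
    rw [pow_succ, ih, pow_succ]
    simp only [Matrix.mul_assoc, Matrix.nonsing_inv_mul_cancel_left _ _ hT]

/-! ### Rank equalities and factorizations. -/

/-- If `r(XY) = r(X)`, then `X` factors through `XY` on the right. -/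
theorem exists_eq_mul_of_rank_mul_eq {a b c : ℕ} (X : Matrix (Fin a) (Fin b) ℂ)
    (Y : Matrix (Fin b) (Fin c) ℂ) (h : (X * Y).rank = X.rank) :
    ∃ Z : Matrix (Fin c) (Fin b) ℂ, X = X * Y * Z := by
  have hle : LinearMap.range (X * Y).mulVecLin ≤ LinearMap.range X.mulVecLin := by
    rw [Matrix.mulVecLin_mul]
    exact LinearMap.range_comp_le_range _ _
  have heq := Submodule.eq_of_le_of_finrank_eq hle h
  have hcol : ∀ j, ∃ z, (X * Y) *ᵥ z = X.col j := by
    intro j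
    have : X.col j ∈ LinearMap.range (X * Y).mulVecLin := by
      rw [heq]
      exact ⟨Pi.single j 1, by simp⟩
    simpa using this
  choose z hz using hcol
  refine ⟨Matrix.of fun i j => z j i, ?_⟩
  ext i j
  have := congrFun (hz j) i
  simpa [Matrix.mul_apply, Matrix.mulVec, dotProduct, Matrix.col] using this.symm

/-- If `r(YX) = r(X)`, then `X` factors through `YX` on the left. -/
theorem exists_eq_mul_of_rank_mul_eq_left {a b c : ℕ} (X : Matrix (Fin a) (Fin b) ℂ)
    (Y : Matrix (Fin c) (Fin a) ℂ) (h : (Y * X).rank = X.rank) :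
    ∃ Z : Matrix (Fin a) (Fin c) ℂ, X = Z * (Y * X) := by
  obtain ⟨Z, hZ⟩ := exists_eq_mul_of_rank_mul_eq Xᵀ Yᵀ (by
    rw [← Matrix.transpose_mul, Matrix.rank_transpose, Matrix.rank_transpose, h])
  refine ⟨Zᵀ, ?_⟩
  have := congrArg Matrix.transpose hZ
  simpa [Matrix.transpose_mul] using this

/-- The ranks of `WA` and `AW` lie between those of `WAW` and `A`, so all four agree. -/
theorem exists_eq_mul_mul_of_rank_eq {m n : ℕ} (A : Matrix (Fin m) (Fin n) ℂ)
    (W : Matrix (Fin n) (Fin m) ℂ) (h : (W * A * W).rank = A.rank) :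
    ∃ Y Z : Matrix (Fin m) (Fin n) ℂ, A = A * W * Z ∧ A = Y * (W * A) := by
  have h1 : (W * A).rank = A.rank :=
    le_antisymm (Matrix.rank_mul_le_right _ _) (h ▸ Matrix.rank_mul_le_left _ _)
  have h2 : (A * W).rank = A.rank :=
    le_antisymm (Matrix.rank_mul_le_left _ _)
      (by rw [← h, Matrix.mul_assoc]; exact Matrix.rank_mul_le_right _ _)
  obtain ⟨Z, hZ⟩ := exists_eq_mul_of_rank_mul_eq A W h2
  obtain ⟨Y, hY⟩ := exists_eq_mul_of_rank_mul_eq_left A W h1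
  exact ⟨Y, Z, hZ, hY⟩

/-- If `r(WAW) = r(A)`, then `AWXWA = A` says that `X` is an inner inverse of `WAW`. -/
theorem inner_iff_of_rank_eq {m n : ℕ} {A : Matrix (Fin m) (Fin n) ℂ}
    {W : Matrix (Fin n) (Fin m) ℂ} (h : (W * A * W).rank = A.rank)
    (X : Matrix (Fin m) (Fin n) ℂ) :
    A * W * X * W * A = A ↔ W * A * W * X * (W * A * W) = W * A * W := by
  constructor
  · intro hX
    calc W * A * W * X * (W * A * W) = W * (A * W * X * W * A) * W := by
          simp only [Matrix.mul_assoc]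
      _ = W * A * W := by rw [hX]
  · intro hX
    -- The two factorizations combine to `A = Y (WAW) Z`, so the inner equation can be sandwiched
    -- between `Y` and `Z`.
    obtain ⟨Y, Z, hZ, hY⟩ := exists_eq_mul_mul_of_rank_eq A W h
    have hM : A = Y * (W * A * W) * Z := by
      calc A = A * W * Z := hZ
        _ = Y * (W * A) * W * Z := by rw [← hY]
        _ = _ := by simp only [Matrix.mul_assoc]
    calc A * W * X * W * A = Y * (W * A) * W * X * W * (A * W * Z) := by rw [← hY, ← hZ]
      _ = Y * (W * A * W * X * (W * A * W)) * Z := by simp only [Matrix.mul_assoc]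
      _ = A := by rw [hX, ← hM]

/-! ### The index and the nilpotent block. -/

/-- Substituting the relation into itself raises the exponent at will, in particular past a
nilpotency degree. -/
theorem pow_factor {m j : ℕ} {M Z : Matrix (Fin m) (Fin m) ℂ} (h : M ^ j = M ^ (j + 1) * Z)
    (i : ℕ) : ∃ Y, M ^ j = M ^ (j + i) * Y := by
  induction i with
  | zero => exact ⟨1, by simp⟩
  | succ i ih =>
    obtain ⟨Y, hY⟩ := ih
    refine ⟨Z * Y, ?_⟩
    calc M ^ j = M ^ (j + i) * Y := hY
      _ = M ^ i * M ^ j * Y := by rw [← pow_add, add_comm i j]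
      _ = M ^ i * (M ^ (j + 1) * Z) * Y := by rw [← h]
      _ = M ^ (i + (j + 1)) * (Z * Y) := by rw [pow_add M i]; simp only [Matrix.mul_assoc]
      _ = _ := by congr 2; omega

/-- The nilpotent part of a core-nilpotent form vanishes at powers from the index on. -/
theorem nilpotent_part_pow_eq_zero {m t k : ℕ} (htm : t ≤ m) {S : Matrix (Fin m) (Fin m) ℂ}
    (hS : IsUnit S) {C : Matrix (Fin t) (Fin t) ℂ} (hC : IsUnit C)
    {N : Matrix (Fin (m - t)) (Fin (m - t)) ℂ} (hN : IsNilpotent N)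
    (hk : matIndex (S * blockMat htm htm C 0 0 N * S⁻¹) ≤ k) : N ^ k = 0 := by
  have hSd := (Matrix.isUnit_iff_isUnit_det S).1 hS
  have hCd := (Matrix.isUnit_iff_isUnit_det C).1 hC
  have hpow : ∀ i, (S * blockMat htm htm C 0 0 N * S⁻¹) ^ i =
      S * blockMat htm htm (C ^ i) 0 0 (N ^ i) * S⁻¹ := by
    intro i
    rw [matrix_conj_pow hSd, blockMat_diag_pow]
  set M := S * blockMat htm htm C 0 0 N * S⁻¹ with hM
  obtain ⟨d, hd⟩ := hN
  -- An empty set would give `sInf` the default value 0; the exponent `d` that kills `N` shows the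
  -- set is nonempty.
  have hne : {k : ℕ | (M ^ k).rank = (M ^ (k + 1)).rank}.Nonempty := by
    refine ⟨d, le_antisymm ?_ ?_⟩
    · have : M ^ d = M ^ (d + 1) * (S * blockMat htm htm C⁻¹ 0 0 0 * S⁻¹) := by
        rw [hpow, hpow]
        simp only [Matrix.mul_assoc, Matrix.nonsing_inv_mul_cancel_left _ _ hSd]
        rw [← Matrix.mul_assoc (blockMat _ _ _ _ _ _), blockMat_mul]
        simp [pow_succ, hd, Matrix.mul_assoc, Matrix.mul_nonsing_inv _ hCd]
      rw [this]
      exact Matrix.rank_mul_le_left _ _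
    · rw [pow_succ]
      exact Matrix.rank_mul_le_left _ _
  have hj : (M ^ matIndex M).rank = (M ^ (matIndex M + 1)).rank := Nat.sInf_mem hne
  obtain ⟨Z, hZ⟩ := exists_eq_mul_of_rank_mul_eq (M ^ matIndex M) M (by
    rw [← pow_succ]; exact hj.symm)
  rw [← pow_succ] at hZ
  -- With `j` the index, the lower right block of `M^j = M^(j+d) Y` reads `N^j = N^(j+d) Y₄ = 0`.
  obtain ⟨Y, hY⟩ := pow_factor hZ d
  obtain ⟨Y₁, Y₂, Y₃, Y₄, hYb⟩ := exists_eq_blockMat htm htm (S⁻¹ * Y * S)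
  rw [hpow, hpow] at hY
  have hY' := congrArg (fun T => S⁻¹ * T * S) hY
  simp only [Matrix.mul_assoc, Matrix.nonsing_inv_mul_cancel_left _ _ hSd,
    Matrix.nonsing_inv_mul _ hSd, Matrix.mul_one] at hY' hYb
  rw [hYb, blockMat_mul, blockMat_inj] at hY'
  have h4 := hY'.2.2.2
  rw [pow_add, hd] at h4
  simp only [Matrix.zero_mul, Matrix.mul_zero, zero_add] at h4
  rw [← Nat.add_sub_of_le hk, pow_add, h4, Matrix.zero_mul]

/-! ### Uniqueness of the weighted Drazin inverse. -/

/-- The equations `ZE = EZ`, `ZEZ = Z`, `ZEᵏ⁺¹ = Eᵏ` determine `Z`. -/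
theorem drazin_unique {M : Type*} [Monoid M] {E Y Z : M} {k : ℕ}
    (hYc : Commute Y E) (hYo : Y * E * Y = Y) (hYp : Y * E ^ (k + 1) = E ^ k)
    (hZc : Commute Z E) (hZo : Z * E * Z = Z) (hZp : Z * E ^ (k + 1) = E ^ k) : Y = Z := by
  have key : ∀ T : M, Commute T E → T * E * T = T → ∀ j, T ^ (j + 1) * E ^ j = T := by
    intro T hc ho j
    induction j with
    | zero => simp
    | succ j ih =>
      calc T ^ (j + 1 + 1) * E ^ (j + 1) = T * (T ^ (j + 1) * E ^ j) * E := by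
            rw [pow_succ' T, pow_succ E]; simp only [mul_assoc]
        _ = T := by rw [ih, mul_assoc, hc.eq, ← mul_assoc, ho]
  have hY : Y = Y * E * Z := by
    calc Y = Y ^ (k + 1) * E ^ k := (key Y hYc hYo k).symm
      _ = Y ^ (k + 1) * (Z * E ^ (k + 1)) := by rw [hZp]
      _ = Y ^ (k + 1) * E ^ k * (E * Z) := by
          rw [(hZc.pow_right (k + 1)).eq, pow_succ E]; simp only [mul_assoc]
      _ = Y * E * Z := by rw [key Y hYc hYo k, mul_assoc]
  have hZ : Z = Y * E * Z := by
    calc Z = Z ^ (k + 1) * E ^ k := (key Z hZc hZo k).symm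
      _ = E ^ k * Z ^ (k + 1) := ((hZc.pow_pow (k + 1) k).eq)
      _ = Y * E * (E ^ k * Z ^ (k + 1)) := by
          rw [← mul_assoc, mul_assoc Y, ← pow_succ', hYp]
      _ = Y * E * Z := by rw [← (hZc.pow_pow (k + 1) k).eq, key Z hZc hZo k]
  rw [hY, ← hZ]

/-- `TW` is the Drazin inverse of `AW`, and `T = (TW)² A` recovers `T` from it. -/
theorem IsWeightedDrazin.unique {m n : ℕ} {A : Matrix (Fin m) (Fin n) ℂ}
    {W : Matrix (Fin n) (Fin m) ℂ} {X Y : Matrix (Fin m) (Fin n) ℂ}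
    (hX : IsWeightedDrazin A W X) (hY : IsWeightedDrazin A W Y) : X = Y := by
  have comm : ∀ T, IsWeightedDrazin A W T → Commute (T * W) (A * W) := fun T h => by
    change T * W * (A * W) = A * W * (T * W)
    rw [← Matrix.mul_assoc, ← Matrix.mul_assoc (A * W), h.comm]
  have outer : ∀ T, IsWeightedDrazin A W T → T * W * (A * W) * (T * W) = T * W := fun T h => by
    rw [← Matrix.mul_assoc, ← Matrix.mul_assoc, h.outer]
  have eq : ∀ T, IsWeightedDrazin A W T → T = T * W * (T * W) * A := fun T h => by
    calc T = T * W * (A * W * T) := by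
          simpa only [Matrix.mul_assoc] using h.outer.symm
      _ = _ := by rw [h.comm]; simp only [Matrix.mul_assoc]
  have h := drazin_unique (comm X hX) (outer X hX) hX.power (comm Y hY) (outer Y hY) hY.power
  rw [eq X hX, eq Y hY, h]

/-! ### Generalized inverses from the singular value decomposition. -/

/-- The `{1, 2, 3}`-inverses of a matrix in terms of its singular value decomposition. -/
theorem inverse123_iff {m n r : ℕ} (hrm : r ≤ m) (hrn : r ≤ n)
    {P : Matrix (Fin n) (Fin n) ℂ} {Q : Matrix (Fin m) (Fin m) ℂ}
    (hP : P ∈ Matrix.unitaryGroup (Fin n) ℂ) (hQ : IsUnit Q)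
    {B : Matrix (Fin r) (Fin r) ℂ} (hB : IsUnit B) {M : Matrix (Fin n) (Fin m) ℂ}
    (hM : M = P * blockMat hrn hrm B 0 0 0 * Q⁻¹) (X : Matrix (Fin m) (Fin n) ℂ) :
    (M * X * M = M ∧ X * M * X = X ∧ (M * X)ᴴ = M * X) ↔
      ∃ C, X = Q * blockMat hrm hrn B⁻¹ 0 C 0 * P⁻¹ := by
  have hPi : P⁻¹ = Pᴴ := Matrix.inv_eq_left_inv (Matrix.mem_unitaryGroup_iff'.1 hP)
  have hPd : IsUnit P.det :=
    (Matrix.isUnit_iff_isUnit_det P).1 ⟨Unitary.toUnits ⟨P, hP⟩, rfl⟩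
  have hQd := (Matrix.isUnit_iff_isUnit_det Q).1 hQ
  have hBd := (Matrix.isUnit_iff_isUnit_det B).1 hB
  obtain ⟨X₁, X₂, X₃, X₄, hXb⟩ := exists_eq_blockMat hrm hrn (Q⁻¹ * X * P)
  have hX : X = Q * blockMat hrm hrn X₁ X₂ X₃ X₄ * P⁻¹ := by
    rw [← hXb]
    simp only [Matrix.mul_assoc, Matrix.mul_nonsing_inv _ hPd, Matrix.mul_one,
      Matrix.mul_nonsing_inv_cancel_left _ _ hQd]
  have hMX : M * X = P * blockMat hrn hrn (B * X₁) (B * X₂) 0 0 * P⁻¹ := by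
    rw [hM, hX]
    simp only [Matrix.mul_assoc, Matrix.nonsing_inv_mul_cancel_left _ _ hQd]
    rw [← Matrix.mul_assoc (blockMat _ _ _ _ _ _), blockMat_mul]
    simp
  have hMXM : M * X * M = P * blockMat hrn hrm (B * X₁ * B) 0 0 0 * Q⁻¹ := by
    rw [hMX, hM]
    simp only [Matrix.mul_assoc, Matrix.nonsing_inv_mul_cancel_left _ _ hPd]
    rw [← Matrix.mul_assoc (blockMat _ _ _ _ _ _), blockMat_mul]
    simp [Matrix.mul_assoc]
  have hXMX : X * M * X = Q * blockMat hrm hrn (X₁ * B * X₁) (X₁ * B * X₂)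
      (X₃ * B * X₁) (X₃ * B * X₂) * P⁻¹ := by
    rw [Matrix.mul_assoc, hMX, hX]
    simp only [Matrix.mul_assoc, Matrix.nonsing_inv_mul_cancel_left _ _ hPd]
    rw [← Matrix.mul_assoc (blockMat _ _ _ _ _ _), blockMat_mul]
    simp
  have hH : (M * X)ᴴ = P * blockMat hrn hrn (B * X₁)ᴴ 0 (B * X₂)ᴴ 0 * P⁻¹ := by
    rw [hMX, hPi]
    simp [Matrix.conjTranspose_mul, blockMat_conjTranspose, Matrix.mul_assoc]
  rw [hMXM, hXMX, hH, hMX, hX]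
  nth_rewrite 1 [hM]
  simp only [mul_mul_inv_inj hPd hPd, mul_mul_inv_inj hPd hQd, mul_mul_inv_inj hQd hPd, blockMat_inj]
  constructor
  -- The inner equation fixes `X₁`, the Hermitian condition kills `X₂`, the outer equation then
  -- kills `X₄`; `X₃` stays free.
  · rintro ⟨⟨h1, -⟩, ⟨-, -, -, h4⟩, ⟨-, h2, -⟩⟩
    have e1 : X₁ = B⁻¹ := by
      have h : B * X₁ = 1 := hB.mul_right_cancel (by rw [h1, Matrix.one_mul])
      exact (Matrix.inv_eq_right_inv h).symm
    have e2 : X₂ = 0 := by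
      rw [← Matrix.nonsing_inv_mul_cancel_left B X₂ hBd, ← h2, Matrix.mul_zero]
    refine ⟨X₃, e1, e2, rfl, ?_⟩
    rw [← h4, e2, Matrix.mul_zero]
  · rintro ⟨C, rfl, rfl, rfl, rfl⟩
    simp [Matrix.mul_assoc, Matrix.nonsing_inv_mul _ hBd, Matrix.mul_nonsing_inv _ hBd]

/-- The fourth Penrose equation makes `[[1, 0], [C B, 0]]` Hermitian, which forces the free block
`C` to vanish. -/
theorem isMoorePenrose_iff {m n r : ℕ} (hrm : r ≤ m) (hrn : r ≤ n)
    {P : Matrix (Fin n) (Fin n) ℂ} {Q : Matrix (Fin m) (Fin m) ℂ}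
    (hP : P ∈ Matrix.unitaryGroup (Fin n) ℂ) (hQ : Q ∈ Matrix.unitaryGroup (Fin m) ℂ)
    {B : Matrix (Fin r) (Fin r) ℂ} (hB : IsUnit B) {M : Matrix (Fin n) (Fin m) ℂ}
    (hM : M = P * blockMat hrn hrm B 0 0 0 * Q⁻¹) (X : Matrix (Fin m) (Fin n) ℂ) :
    IsMoorePenrose M X ↔ X = Q * blockMat hrm hrn B⁻¹ 0 0 0 * P⁻¹ := by
  have hQi : Q⁻¹ = Qᴴ := Matrix.inv_eq_left_inv (Matrix.mem_unitaryGroup_iff'.1 hQ)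
  have hQu : IsUnit Q := ⟨Unitary.toUnits ⟨Q, hQ⟩, rfl⟩
  have hQd := (Matrix.isUnit_iff_isUnit_det Q).1 hQu
  have hPd : IsUnit P.det :=
    (Matrix.isUnit_iff_isUnit_det P).1 ⟨Unitary.toUnits ⟨P, hP⟩, rfl⟩
  have hBd := (Matrix.isUnit_iff_isUnit_det B).1 hB
  have hXM : ∀ C, Q * blockMat hrm hrn B⁻¹ 0 C 0 * P⁻¹ * M =
      Q * blockMat hrm hrm 1 0 (C * B) 0 * Q⁻¹ := by
    intro C
    rw [hM]
    simp only [Matrix.mul_assoc, Matrix.nonsing_inv_mul_cancel_left _ _ hPd]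
    rw [← Matrix.mul_assoc (blockMat _ _ _ _ _ _), blockMat_mul]
    simp [Matrix.nonsing_inv_mul _ hBd]
  have hH : ∀ C : Matrix (Fin (m - r)) (Fin r) ℂ,
      (Q * blockMat hrm hrm 1 0 (C * B) 0 * Q⁻¹)ᴴ =
      Q * blockMat hrm hrm 1 (C * B)ᴴ 0 0 * Q⁻¹ := by
    intro C
    rw [hQi]
    simp [Matrix.conjTranspose_mul, blockMat_conjTranspose, Matrix.mul_assoc]
  constructor
  · rintro ⟨h1, h2, h3, h4⟩
    obtain ⟨C, rfl⟩ := (inverse123_iff hrm hrn hP hQu hB hM X).1 ⟨h1, h2, h3⟩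
    rw [hXM, hH] at h4
    have h5 := congrArg (fun U => Q⁻¹ * U * Q) h4
    simp only [Matrix.mul_assoc, Matrix.nonsing_inv_mul _ hQd, Matrix.mul_one,
      Matrix.nonsing_inv_mul_cancel_left _ _ hQd, blockMat_inj] at h5
    have h6 : C = 0 := by
      rw [← Matrix.mul_nonsing_inv_cancel_right B C hBd, ← h5.2.2.1, Matrix.zero_mul]
    rw [h6]
  · rintro rfl
    obtain ⟨h1, h2, h3⟩ := (inverse123_iff hrm hrn hP hQu hB hM _).2 ⟨0, rfl⟩
    refine ⟨h1, h2, h3, ?_⟩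
    rw [hXM, hH]
    simp

/-! ### The canonical forms. -/

theorem mainTheorem5 {m n r t k : ℕ}
    (A : Matrix (Fin m) (Fin n) ℂ) (W : Matrix (Fin n) (Fin m) ℂ)
    (hk : k = weightedIndex A W)
    (hrank : (W * A * W).rank = A.rank) (hr : A.rank = r)
    (hrm : r ≤ m) (hrn : r ≤ n) (htm : t ≤ m) (htn : t ≤ n)
    -- the decomposition of `A` and `W` coming from the core-nilpotent forms of `AW` and `WA`
    (S : Matrix (Fin m) (Fin m) ℂ) (R : Matrix (Fin n) (Fin n) ℂ)
    (A₁ W₁ : Matrix (Fin t) (Fin t) ℂ)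
    (A₂ : Matrix (Fin (m - t)) (Fin (n - t)) ℂ) (W₂ : Matrix (Fin (n - t)) (Fin (m - t)) ℂ)
    (hS : IsUnit S) (hR : IsUnit R) (hA₁ : IsUnit A₁) (hW₁ : IsUnit W₁)
    (hN : IsNilpotent (A₂ * W₂)) (hN' : IsNilpotent (W₂ * A₂))
    (hA : A = S * blockMat htm htn A₁ 0 0 A₂ * R⁻¹)
    (hW : W = R * blockMat htn htm W₁ 0 0 W₂ * S⁻¹)
    -- the singular value decomposition of `WAW`
    (P : Matrix (Fin n) (Fin n) ℂ) (Q : Matrix (Fin m) (Fin m) ℂ)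
    (hP : P ∈ Matrix.unitaryGroup (Fin n) ℂ) (hQ : Q ∈ Matrix.unitaryGroup (Fin m) ℂ)
    (σ : Fin r → ℝ) (hσ : ∀ i, 0 < σ i)
    (B₁ : Matrix (Fin r) (Fin r) ℂ) (hB₁ : B₁ = Matrix.diagonal (fun i => (σ i : ℂ)))
    (hWAW : W * A * W = P * blockMat hrn hrm B₁ 0 0 0 * Q⁻¹)
    -- the blocks of `Q⁻¹S` and `R⁻¹P`
    (Q₁ : Matrix (Fin r) (Fin t) ℂ) (Q₂ : Matrix (Fin r) (Fin (m - t)) ℂ)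
    (Q₃ : Matrix (Fin (m - r)) (Fin t) ℂ) (Q₄ : Matrix (Fin (m - r)) (Fin (m - t)) ℂ)
    (hQS : Q⁻¹ * S = blockMat hrm htm Q₁ Q₂ Q₃ Q₄)
    (R₁ : Matrix (Fin t) (Fin r) ℂ) (R₂ : Matrix (Fin t) (Fin (n - r)) ℂ)
    (R₃ : Matrix (Fin (n - t)) (Fin r) ℂ) (R₄ : Matrix (Fin (n - t)) (Fin (n - r)) ℂ)
    (hRP : R⁻¹ * P = blockMat htn hrn R₁ R₂ R₃ R₄) :
    -- the weighted Drazin inverse of `A` and the Moore-Penrose inverse of `WAW`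
    (∀ D, IsWeightedDrazin A W D ↔
      D = S * blockMat htm htn (W₁ * A₁ * W₁)⁻¹ 0 0 0 * R⁻¹) ∧
    (∀ M, IsMoorePenrose (W * A * W) M ↔
      M = Q * blockMat hrm hrn B₁⁻¹ 0 0 0 * P⁻¹) ∧
    -- the canonical form of the particular weighted inverse built from these two inverses
    (∀ D M, IsWeightedDrazin A W D → IsMoorePenrose (W * A * W) M →
      M + (1 - M * (W * A * W)) * D * (W * A * W) * M =
        Q * blockMat hrm hrn B₁⁻¹ 0 (Q₃ * (W₁ * A₁ * W₁)⁻¹ * R₁) 0 * P⁻¹) ∧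
    -- the two canonical forms are weighted inverses, and each of them yields all the others
    (∀ A₀ : Matrix (Fin m) (Fin n) ℂ,
      (A₀ = Q * blockMat hrm hrn B₁⁻¹ 0
            (Q₃ * (W₁ * A₁ * W₁)⁻¹ * R₁ + Q₄ * A₂ * R₃) 0 * P⁻¹ ∨
        A₀ = Q * blockMat hrm hrn B₁⁻¹ 0 (Q₃ * (W₁ * A₁ * W₁)⁻¹ * R₁) 0 * P⁻¹) →
      A₀ ∈ weightedInverses A W k ∧
      (∀ X ∈ weightedInverses A W k,
        ∃ (U : Matrix (Fin m) (Fin m) ℂ)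
          (U₁ : Matrix (Fin r) (Fin r) ℂ) (U₂ : Matrix (Fin r) (Fin (m - r)) ℂ)
          (U₃ : Matrix (Fin (m - r)) (Fin r) ℂ) (U₄ : Matrix (Fin (m - r)) (Fin (m - r)) ℂ),
          Q⁻¹ * U * Q = blockMat hrm hrm U₁ U₂ U₃ U₄ ∧
          X = A₀ + Q * blockMat hrm hrn 0 0
            (U₃ * (B₁⁻¹ - Q₁ * (W₁ * A₁ * W₁)⁻¹ * R₁)
              - U₄ * Q₃ * (W₁ * A₁ * W₁)⁻¹ * R₁) 0 * P⁻¹) ∧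
      (∀ X, X ∈ weightedInverses A W k ↔
        ∃ U₃ : Matrix (Fin (m - r)) (Fin r) ℂ,
          X = A₀ + Q * blockMat hrm hrn 0 0
            (U₃ * (B₁⁻¹ - Q₁ * (W₁ * A₁ * W₁)⁻¹ * R₁)) 0 * P⁻¹)) := by
  have hSd := (Matrix.isUnit_iff_isUnit_det S).1 hS
  have hRd := (Matrix.isUnit_iff_isUnit_det R).1 hR
  have hWd := (Matrix.isUnit_iff_isUnit_det W₁).1 hW₁
  have hPd : IsUnit P.det :=
    (Matrix.isUnit_iff_isUnit_det P).1 ⟨Unitary.toUnits ⟨P, hP⟩, rfl⟩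
  have hQu : IsUnit Q := ⟨Unitary.toUnits ⟨Q, hQ⟩, rfl⟩
  have hQd := (Matrix.isUnit_iff_isUnit_det Q).1 hQu
  have hBd : IsUnit B₁.det := by
    rw [hB₁, Matrix.det_diagonal, isUnit_iff_ne_zero, Finset.prod_ne_zero_iff]
    exact fun i _ => Complex.ofReal_ne_zero.2 (hσ i).ne'
  have hBu : IsUnit B₁ := (Matrix.isUnit_iff_isUnit_det B₁).2 hBd
  have hAW : A * W = S * blockMat htm htm (A₁ * W₁) 0 0 (A₂ * W₂) * S⁻¹ := by
    rw [hA, hW]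
    simp only [Matrix.mul_assoc, Matrix.nonsing_inv_mul_cancel_left _ _ hRd]
    rw [← Matrix.mul_assoc (blockMat _ _ _ _ _ _), blockMat_mul]
    simp
  have hWA : W * A = R * blockMat htn htn (W₁ * A₁) 0 0 (W₂ * A₂) * R⁻¹ := by
    rw [hA, hW]
    simp only [Matrix.mul_assoc, Matrix.nonsing_inv_mul_cancel_left _ _ hSd]
    rw [← Matrix.mul_assoc (blockMat _ _ _ _ _ _), blockMat_mul]
    simp
  have hM : W * A * W = R * blockMat htn htm (W₁ * A₁ * W₁) 0 0 (W₂ * A₂ * W₂) * S⁻¹ := by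
    rw [hWA, hW]
    simp only [Matrix.mul_assoc, Matrix.nonsing_inv_mul_cancel_left _ _ hRd]
    rw [← Matrix.mul_assoc (blockMat _ _ _ _ _ _), blockMat_mul]
    simp [Matrix.mul_assoc]
  have hNk : (A₂ * W₂) ^ k = 0 := by
    refine nilpotent_part_pow_eq_zero htm hS (hA₁.mul hW₁) hN ?_
    rw [← hAW, hk]
    exact le_max_left _ _
  have hAWk : (A * W) ^ k = S * blockMat htm htm ((A₁ * W₁) ^ k) 0 0 0 * S⁻¹ := by
    rw [hAW, matrix_conj_pow hSd, blockMat_diag_pow, hNk]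
  -- One factor `AW` of the power `k + 1` is spent on forming `WAW`.
  have hXk : ∀ X : Matrix (Fin m) (Fin n) ℂ,
      X * W * (A * W) ^ (k + 1) = X * (W * A * W) * (A * W) ^ k := by
    intro X
    rw [pow_succ']
    simp only [Matrix.mul_assoc]
  set G := (W₁ * A₁ * W₁)⁻¹ with hG
  have hGu : IsUnit (W₁ * A₁ * W₁) := (hW₁.mul hA₁).mul hW₁
  have hGd := (Matrix.isUnit_iff_isUnit_det _).1 hGu
  have hGM : G * (W₁ * A₁ * W₁) = 1 := Matrix.nonsing_inv_mul _ hGd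
  have hMG : (W₁ * A₁ * W₁) * G = 1 := Matrix.mul_nonsing_inv _ hGd
  -- comparison of the two forms of `WAW`
  have hblocks : blockMat htn htm (W₁ * A₁ * W₁) 0 0 (W₂ * A₂ * W₂) =
      blockMat htn htm (R₁ * B₁ * Q₁) (R₁ * B₁ * Q₂) (R₃ * B₁ * Q₁) (R₃ * B₁ * Q₂) := by
    have h1 : blockMat htn htm (W₁ * A₁ * W₁) 0 0 (W₂ * A₂ * W₂) =
        R⁻¹ * (W * A * W) * S := by
      rw [hM]
      simp only [Matrix.mul_assoc, Matrix.nonsing_inv_mul _ hSd, Matrix.mul_one,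
        Matrix.nonsing_inv_mul_cancel_left _ _ hRd]
    have h2 : R⁻¹ * (W * A * W) * S =
        (R⁻¹ * P) * blockMat hrn hrm B₁ 0 0 0 * (Q⁻¹ * S) := by
      rw [hWAW]
      simp only [Matrix.mul_assoc]
    rw [h1, h2, hRP, hQS, blockMat_mul, blockMat_mul]
    simp
  obtain ⟨hb1, -, hb3, -⟩ := (blockMat_inj _ _).1 hblocks
  -- the Drazin inverse
  have hGW : G * (W₁ * A₁) = W₁⁻¹ := by
    rw [← Matrix.mul_nonsing_inv_cancel_right W₁ (G * (W₁ * A₁)) hWd, Matrix.mul_assoc G, hGM,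
      Matrix.one_mul]
  have hWG : A₁ * W₁ * G = W₁⁻¹ := by
    rw [← Matrix.nonsing_inv_mul_cancel_left W₁ (A₁ * W₁ * G) hWd, ← Matrix.mul_assoc W₁,
      ← Matrix.mul_assoc W₁, hMG, Matrix.mul_one]
  have hDM : S * blockMat htm htn G 0 0 0 * R⁻¹ * (W * A * W) =
      S * blockMat htm htm 1 0 0 0 * S⁻¹ := by
    rw [hM]
    simp only [Matrix.mul_assoc, Matrix.nonsing_inv_mul_cancel_left _ _ hRd]
    rw [← Matrix.mul_assoc (blockMat _ _ _ _ _ _), blockMat_mul]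
    rw [Matrix.mul_assoc W₁] at hGM
    simp [hGM]
  have hD : IsWeightedDrazin A W (S * blockMat htm htn G 0 0 0 * R⁻¹) := by
    refine ⟨?_, ?_, ?_⟩
    · rw [← hk, hXk, hDM, hAWk]
      simp only [Matrix.mul_assoc, Matrix.nonsing_inv_mul_cancel_left _ _ hSd]
      rw [← Matrix.mul_assoc (blockMat _ _ _ _ _ _), blockMat_mul]
      simp
    · have : ∀ X : Matrix (Fin m) (Fin n) ℂ, X * W * A * W * X = X * (W * A * W) * X := by
        intro X
        simp only [Matrix.mul_assoc]
      rw [this, hDM]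
      simp only [Matrix.mul_assoc, Matrix.nonsing_inv_mul_cancel_left _ _ hSd]
      rw [← Matrix.mul_assoc (blockMat _ _ _ _ _ _), blockMat_mul]
      simp
    · rw [hAW, Matrix.mul_assoc _ W A, hWA]
      simp only [Matrix.mul_assoc, Matrix.nonsing_inv_mul_cancel_left _ _ hSd,
        Matrix.nonsing_inv_mul_cancel_left _ _ hRd]
      rw [← Matrix.mul_assoc (blockMat _ _ _ _ _ _), ← Matrix.mul_assoc (blockMat _ _ _ _ _ _),
        blockMat_mul, blockMat_mul]
      simp [hGW, hWG]
  have hDiff : ∀ D, IsWeightedDrazin A W D ↔ D = S * blockMat htm htn G 0 0 0 * R⁻¹ :=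
    fun D => ⟨fun h => h.unique hD, fun h => h ▸ hD⟩
  have hMP := isMoorePenrose_iff hrm hrn hP hQ hBu hWAW
  have hXM : ∀ C, Q * blockMat hrm hrn B₁⁻¹ 0 C 0 * P⁻¹ * (W * A * W) =
      Q * blockMat hrm hrm 1 0 (C * B₁) 0 * Q⁻¹ := by
    intro C
    rw [hWAW]
    simp only [Matrix.mul_assoc, Matrix.nonsing_inv_mul_cancel_left _ _ hPd]
    rw [← Matrix.mul_assoc (blockMat _ _ _ _ _ _), blockMat_mul]
    simp [Matrix.nonsing_inv_mul _ hBd]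
  -- membership in terms of the lower left block
  have hmem : ∀ X, X ∈ weightedInverses A W k ↔
      ∃ C, X = Q * blockMat hrm hrn B₁⁻¹ 0 C 0 * P⁻¹ ∧ C * B₁ * Q₁ = Q₃ := by
    have hpow : ∀ C : Matrix (Fin (m - r)) (Fin r) ℂ,
        Q * blockMat hrm hrn B₁⁻¹ 0 C 0 * P⁻¹ * W * (A * W) ^ (k + 1) = (A * W) ^ k ↔
          C * B₁ * Q₁ = Q₃ := by
      intro C
      -- Invertibility of the core block lets its `k`-th power be cancelled.
      have hEu : IsUnit ((A₁ * W₁) ^ k) := (hA₁.mul hW₁).pow k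
      have hEd := (Matrix.isUnit_iff_isUnit_det _).1 hEu
      have h1 : Q * blockMat hrm hrn B₁⁻¹ 0 C 0 * P⁻¹ * W * (A * W) ^ (k + 1) =
          Q * blockMat hrm htm (Q₁ * (A₁ * W₁) ^ k) 0 (C * B₁ * Q₁ * (A₁ * W₁) ^ k) 0 * S⁻¹ := by
        rw [hXk, hXM, hAWk]
        have : Q * blockMat hrm hrm 1 0 (C * B₁) 0 * Q⁻¹ *
            (S * blockMat htm htm ((A₁ * W₁) ^ k) 0 0 0 * S⁻¹) =
            Q * (blockMat hrm hrm 1 0 (C * B₁) 0 * (Q⁻¹ * S) *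
              blockMat htm htm ((A₁ * W₁) ^ k) 0 0 0) * S⁻¹ := by
          simp only [Matrix.mul_assoc]
        rw [this, hQS, blockMat_mul, blockMat_mul]
        simp
      have h2 : (A * W) ^ k =
          Q * blockMat hrm htm (Q₁ * (A₁ * W₁) ^ k) 0 (Q₃ * (A₁ * W₁) ^ k) 0 * S⁻¹ := by
        have : S = Q * (Q⁻¹ * S) := (Matrix.mul_nonsing_inv_cancel_left _ _ hQd).symm
        rw [hAWk]
        nth_rewrite 1 [this]
        rw [Matrix.mul_assoc Q, hQS, blockMat_mul]
        simp
      rw [h1, h2, mul_mul_inv_inj hQd hSd, blockMat_inj]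
      refine ⟨fun h => ?_, fun h => by simp [h]⟩
      rw [← Matrix.mul_nonsing_inv_cancel_right _ (C * B₁ * Q₁) hEd, h.2.2.1,
        Matrix.mul_nonsing_inv_cancel_right _ _ hEd]
    intro X
    have houter : X * W * A * W * X = X * (W * A * W) * X := by
      simp only [Matrix.mul_assoc]
    have h123 := inverse123_iff hrm hrn hP hQu hBu hWAW X
    change (_ ∧ _ ∧ _ ∧ _) ↔ _
    rw [inner_iff_of_rank_eq hrank, houter]
    constructor
    · rintro ⟨h1, h2, h3, h4⟩
      obtain ⟨C, rfl⟩ := h123.1 ⟨h1, h2, h3⟩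
      exact ⟨C, rfl, (hpow C).1 h4⟩
    · rintro ⟨C, rfl, hC⟩
      obtain ⟨h1, h2, h3⟩ := h123.2 ⟨C, rfl⟩
      exact ⟨h1, h2, h3, (hpow C).2 hC⟩
  have hC₀ : Q₃ * G * R₁ * B₁ * Q₁ = Q₃ := by
    have : Q₃ * G * R₁ * B₁ * Q₁ = Q₃ * (G * (R₁ * B₁ * Q₁)) := by
      simp only [Matrix.mul_assoc]
    rw [this, ← hb1, hGM, Matrix.mul_one]
  have hadd : ∀ C E : Matrix (Fin (m - r)) (Fin r) ℂ,
      Q * blockMat hrm hrn B₁⁻¹ 0 C 0 * P⁻¹ + Q * blockMat hrm hrn 0 0 E 0 * P⁻¹ =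
        Q * blockMat hrm hrn B₁⁻¹ 0 (C + E) 0 * P⁻¹ := by
    intro C E
    rw [← Matrix.add_mul, ← Matrix.mul_add, blockMat_add]
    simp
  refine ⟨hDiff, hMP, ?_, ?_⟩
  · intro D M hDD hMM
    rw [hMP] at hMM
    rw [hDiff] at hDD
    have hMM' : M * (W * A * W) = Q * blockMat hrm hrm 1 0 0 0 * Q⁻¹ := by
      rw [hMM, hXM, Matrix.zero_mul]
    have h1 : 1 - M * (W * A * W) = Q * blockMat hrm hrm 0 0 0 1 * Q⁻¹ := by
      rw [hMM', sub_eq_iff_eq_add, ← Matrix.add_mul, ← Matrix.mul_add, blockMat_add]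
      simp [blockMat_one, Matrix.mul_nonsing_inv _ hQd]
    have h2 : Q * blockMat hrm hrm 0 0 0 1 * Q⁻¹ * D * (W * A * W) * M =
        Q * (blockMat hrm hrm 0 0 0 1 * (Q⁻¹ * S) * blockMat htm htn G 0 0 0 * (R⁻¹ * P) *
          (blockMat hrn hrm B₁ 0 0 0 * blockMat hrm hrn B₁⁻¹ 0 0 0)) * P⁻¹ := by
      rw [hDD, hMM, hWAW]
      simp only [Matrix.mul_assoc, Matrix.nonsing_inv_mul_cancel_left _ _ hQd]
    rw [h1, h2, hMM, hQS, hRP]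
    simp only [blockMat_mul]
    simp [Matrix.mul_nonsing_inv _ hBd, hadd]
  · intro A₀ hA₀
    obtain ⟨C, rfl, hC⟩ : ∃ C, A₀ = Q * blockMat hrm hrn B₁⁻¹ 0 C 0 * P⁻¹ ∧ C * B₁ * Q₁ = Q₃ := by
      rcases hA₀ with h | h
      · refine ⟨_, h, ?_⟩
        have : Q₄ * A₂ * R₃ * B₁ * Q₁ = Q₄ * A₂ * (R₃ * B₁ * Q₁) := by
          simp only [Matrix.mul_assoc]
        rw [Matrix.add_mul, Matrix.add_mul, hC₀, this, ← hb3, Matrix.mul_zero, add_zero]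
      · exact ⟨_, h, hC₀⟩
    have hexact : ∀ X, X ∈ weightedInverses A W k ↔
        ∃ U₃ : Matrix (Fin (m - r)) (Fin r) ℂ,
          X = Q * blockMat hrm hrn B₁⁻¹ 0 C 0 * P⁻¹ + Q * blockMat hrm hrn 0 0
            (U₃ * (B₁⁻¹ - Q₁ * G * R₁)) 0 * P⁻¹ := by
      intro X
      rw [hmem]
      constructor
      · rintro ⟨C', rfl, hC'⟩
        -- `E = C' - C` satisfies `E B₁ Q₁ = 0`, hence `E B₁ (B₁⁻¹ - Q₁ G R₁) = E`.
        refine ⟨(C' - C) * B₁, ?_⟩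
        have h0 : (C' - C) * B₁ * (Q₁ * G * R₁) = 0 := by
          have : (C' - C) * B₁ * (Q₁ * G * R₁) = (C' * B₁ * Q₁ - C * B₁ * Q₁) * (G * R₁) := by
            simp only [Matrix.mul_assoc, Matrix.sub_mul]
          rw [this, hC, hC', sub_self, Matrix.zero_mul]
        rw [hadd, Matrix.mul_sub, h0, Matrix.mul_nonsing_inv_cancel_right _ _ hBd]
        simp
      · rintro ⟨U₃, rfl⟩
        refine ⟨_, hadd _ _, ?_⟩
        have h0 : (B₁⁻¹ - Q₁ * G * R₁) * B₁ * Q₁ = 0 := by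
          have : Q₁ * G * R₁ * B₁ * Q₁ = Q₁ * (G * (R₁ * B₁ * Q₁)) := by
            simp only [Matrix.mul_assoc]
          rw [Matrix.sub_mul, Matrix.sub_mul, this, ← hb1, hGM, Matrix.nonsing_inv_mul _ hBd]
          simp
        rw [Matrix.add_mul, Matrix.add_mul, hC, Matrix.mul_assoc U₃, Matrix.mul_assoc U₃, h0]
        simp
    refine ⟨(hmem _).2 ⟨C, rfl, hC⟩, ?_, hexact⟩
    intro X hX
    obtain ⟨U₃, hU₃⟩ := (hexact X).1 hX
    -- Taking `U₄ = 0` reduces the general form to the exact one.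
    refine ⟨Q * blockMat hrm hrm 0 0 U₃ 0 * Q⁻¹, 0, 0, U₃, 0, ?_, ?_⟩
    · simp only [Matrix.mul_assoc, Matrix.nonsing_inv_mul _ hQd, Matrix.mul_one,
        Matrix.nonsing_inv_mul_cancel_left _ _ hQd]
    · rw [hU₃]
      simp
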